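/- A symmetric monoidal $\mathbb{Q}_{\ge 0}$-linear category is a symmetric monoidal category $(\mathcal{C},\otimes,I)$ in which every hom-set is a module over the semiring $\mathbb{Q}_{\ge 0}$ of nonnegative rationals and both composition and $\otimes$ on morphisms are $\mathbb{Q}_{\ge 0}$-bilinear (in particular biadditive, and $0$ is absorbing for both). Let $\mathcal{C}$ be such a category. We write $f;g$ for composition in diagrammatic order. A binomial graded bimonoid in $\mathcal{C}$ is a family $(A_n)_{n\ge 1}$ of objects together with morphisms $\nabla_{n,p}:A_n\otimes A_p\to A_{n+p}$ and $\Delta_{n,p}:A_{n+p}\to A_n\otimes A_p$ for $n,p\ge 1$, such that: 1. for all $n,p,q,r\ge 1$ with $n+p=q+r$, $$\nabla_{n,p};\Delta_{q,r}=\sum_{\substack{a,b,c,d\ge 0\\ a+b=n,\ c+d=p\\ a+c=q,\ b+d=r}}(\Delta_{a,b}\otimes\Delta_{c,d});(1_{A_a}\otimes\gamma_{A_b,A_c}\otimes 1_{A_d});(\nabla_{a,c}\otimes\nabla_{b,d}),$$ where $\gamma$ is the symmetry and, by convention, $A_0=I$ and $\nabla_{0,n},\nabla_{n,0},\Delta_{0,n},\Delta_{n,0}$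 are the unitors of $\mathcal{C}$ and their inverses (associators are omitted); 2. for all $n,p\ge 1$, $\Delta_{n,p};\nabla_{n,p}=\binom{n+p}{n}\,1_{A_{n+p}}$. A morphism $(A_n)_{n \ge 1}\to(B_n)_{n \ge 1}$ of binomial graded bimonoids is a family of morphisms $(f_n:A_n\to B_n)_{n\ge 1}$ such that $\nabla^A_{n,p};f_{n+p}=(f_n\otimes f_p);\nabla^B_{n,p}$ and $\Delta^A_{n,p};(f_n\otimes f_p)=f_{n+p};\Delta^B_{n,p}$ for all $n,p\ge 1$. With degreewise identities and composition, binomial graded bimonoids in $\mathcal{C}$ form a category, and isomorphisms of binomial graded bimonoids are the isomorphisms of this category. Theorem. (i) Let $((A_n)_{n \ge 1},(\nabla^1_{n,p}),(\Delta^1_{n,p}))$ and $((A_n)_{n \ge 1},(\nabla^2_{n,p}),(\Delta^2_{n,p}))$ be two binomial graded bimonoids in $\mathcal{C}$ with the same underlying graded object. Then they are isomorphic as binomial graded bimonoids. (ii) Let $B=((A_n)_{n \ge 1},(\nabla^1_{n,p}),(\Delta^1_{n,p}))$ and $B'=((B_n)_{n \ge 1},(\nabla^2_{n,p}),(\Delta^2_{n,p}))$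 be two binomial graded bimonoids in $\mathcal{C}$ such that $A_1\cong B_1$ in $\mathcal{C}$. Then $B$ and $B'$ are isomorphic as binomial graded bimonoids. -/

import Mathlib

open CategoryTheory MonoidalCategory

universe v u w

/-- A monoidal category enriched over commutative monoids, i.e. a monoidal `ℕ`-linear category:
hom-sets are commutative monoids and composition and tensor product are biadditive. Negatives are
not assumed to exist, so `Preadditive` does not apply. -/
class AdditiveMonoidalCategory (C : Type u) [Category.{v} C] [MonoidalCategory C] where
  homAddCommMonoid : ∀ X Y : C, AddCommMonoid (X ⟶ Y)
  add_comp : ∀ {X Y Z : C} (f g : X ⟶ Y) (h : Y ⟶ Z), (f + g) ≫ h = f ≫ h + g ≫ h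
  comp_add : ∀ {X Y Z : C} (f : X ⟶ Y) (g h : Y ⟶ Z), f ≫ (g + h) = f ≫ g + f ≫ h
  zero_comp : ∀ {X Y Z : C} (f : Y ⟶ Z), (0 : X ⟶ Y) ≫ f = 0
  comp_zero : ∀ {X Y Z : C} (f : X ⟶ Y), f ≫ (0 : Y ⟶ Z) = 0
  add_tensor : ∀ {X Y X' Y' : C} (f g : X ⟶ Y) (h : X' ⟶ Y'),
    (f + g) ⊗ₘ h = (f ⊗ₘ h) + (g ⊗ₘ h)
  tensor_add : ∀ {X Y X' Y' : C} (f : X ⟶ Y) (g h : X' ⟶ Y'),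
    f ⊗ₘ (g + h) = (f ⊗ₘ g) + (f ⊗ₘ h)
  zero_tensor : ∀ {X Y X' Y' : C} (f : X' ⟶ Y'), (0 : X ⟶ Y) ⊗ₘ f = 0
  tensor_zero : ∀ {X Y X' Y' : C} (f : X ⟶ Y), f ⊗ₘ (0 : X' ⟶ Y') = 0

attribute [reducible, instance] AdditiveMonoidalCategory.homAddCommMonoid

/-- A monoidal `k`-linear category, for a commutative semiring `k`: the hom-sets are `k`-modules
and composition and tensor product are `k`-bilinear. -/
class LinearMonoidalCategory (k : Type w) [CommSemiring k] (C : Type u) [Category.{v} C]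
    [MonoidalCategory C] [AdditiveMonoidalCategory C] where
  homModule : ∀ X Y : C, Module k (X ⟶ Y)
  smul_comp : ∀ {X Y Z : C} (c : k) (f : X ⟶ Y) (g : Y ⟶ Z), (c • f) ≫ g = c • (f ≫ g)
  comp_smul : ∀ {X Y Z : C} (c : k) (f : X ⟶ Y) (g : Y ⟶ Z), f ≫ (c • g) = c • (f ≫ g)
  smul_tensor : ∀ {X Y X' Y' : C} (c : k) (f : X ⟶ Y) (g : X' ⟶ Y'),
    (c • f) ⊗ₘ g = c • (f ⊗ₘ g)
  tensor_smul : ∀ {X Y X' Y' : C} (c : k) (f : X ⟶ Y) (g : X' ⟶ Y'),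
    f ⊗ₘ (c • g) = c • (f ⊗ₘ g)

attribute [reducible, instance] LinearMonoidalCategory.homModule

namespace BinGrBimon

section ZeroStrings

variable {C : Type u} [Category.{v} C] [MonoidalCategory C]

/-- The family `(A n)_{n ≥ 1}` extended to `n = 0` by the monoidal unit: a string indexed by `0`
is an erased string. -/
def extObj (A : ℕ+ → C) : ℕ → C
  | 0 => 𝟙_ C
  | n + 1 => A n.succPNat

/-- The multiplications extended to indices `0` by the unitors. The target index `m` is any number
equal to `a + b`. -/
def extMul (A : ℕ+ → C) (mul : ∀ n p : ℕ+, A n ⊗ A p ⟶ A (n + p)) :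
    ∀ a b m : ℕ, a + b = m → (extObj A a ⊗ extObj A b ⟶ extObj A m)
  | 0, b, _, h => (λ_ (extObj A b)).hom ≫ eqToHom (congrArg (extObj A) (by omega))
  | a + 1, 0, _, h => (ρ_ (extObj A (a + 1))).hom ≫ eqToHom (congrArg (extObj A) (by omega))
  | _ + 1, _ + 1, 0, h => absurd h (by omega)
  | a + 1, b + 1, m + 1, h => mul a.succPNat b.succPNat ≫
      eqToHom (congrArg A (show a.succPNat + b.succPNat = m.succPNat from PNat.eq h))

/-- The comultiplications extended to indices `0` by the inverse unitors. -/
def extComul (A : ℕ+ → C) (comul : ∀ n p : ℕ+, A (n + p) ⟶ A n ⊗ A p) :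
    ∀ a b m : ℕ, a + b = m → (extObj A m ⟶ extObj A a ⊗ extObj A b)
  | 0, b, _, h => eqToHom (congrArg (extObj A) (by omega)) ≫ (λ_ (extObj A b)).inv
  | a + 1, 0, _, h => eqToHom (congrArg (extObj A) (by omega)) ≫ (ρ_ (extObj A (a + 1))).inv
  | _ + 1, _ + 1, 0, h => absurd h (by omega)
  | a + 1, b + 1, m + 1, h =>
      eqToHom (congrArg A (show m.succPNat = a.succPNat + b.succPNat from PNat.eq h.symm)) ≫
        comul a.succPNat b.succPNat

end ZeroStrings

/-- The quadruples `((a, b), (c, d))` of nonnegative integers with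
`a + b = n`, `c + d = p`, `a + c = q`, `b + d = r`. -/
abbrev Splitting (n p q r : ℕ) : Type :=
  {x : (ℕ × ℕ) × (ℕ × ℕ) // x.1.1 + x.1.2 = n ∧ x.2.1 + x.2.2 = p ∧
    x.1.1 + x.2.1 = q ∧ x.1.2 + x.2.2 = r}

instance Splitting.fintype (n p q r : ℕ) : Fintype (Splitting n p q r) :=
  Fintype.subtype
    ((Finset.HasAntidiagonal.antidiagonal n ×ˢ Finset.HasAntidiagonal.antidiagonal p).filter
      fun x => x.1.1 + x.2.1 = q ∧ x.1.2 + x.2.2 = r)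
    (by
      intro x
      simp only [Finset.mem_filter, Finset.mem_product, Finset.HasAntidiagonal.mem_antidiagonal]
      tauto)

/-- The summand of the compatibility axiom indexed by `(a, b, c, d)`: comultiply
`A n ⊗ A p ⟶ (A a ⊗ A b) ⊗ (A c ⊗ A d)`, exchange the two middle factors with the symmetry, and
multiply `(A a ⊗ A c) ⊗ (A b ⊗ A d) ⟶ A q ⊗ A r`. -/
def crossTerm {C : Type u} [Category.{v} C] [MonoidalCategory C] [SymmetricCategory C]
    (A : ℕ+ → C) (mul : ∀ n p : ℕ+, A n ⊗ A p ⟶ A (n + p))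
    (comul : ∀ n p : ℕ+, A (n + p) ⟶ A n ⊗ A p)
    {n p q r : ℕ} (x : Splitting n p q r) :
    extObj A n ⊗ extObj A p ⟶ extObj A q ⊗ extObj A r :=
  (extComul A comul x.1.1.1 x.1.1.2 n x.2.1 ⊗ₘ extComul A comul x.1.2.1 x.1.2.2 p x.2.2.1) ≫
    tensorμ (extObj A x.1.1.1) (extObj A x.1.1.2) (extObj A x.1.2.1) (extObj A x.1.2.2) ≫
      (extMul A mul x.1.1.1 x.1.2.1 q x.2.2.2.1 ⊗ₘ extMul A mul x.1.1.2 x.1.2.2 r x.2.2.2.2)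

end BinGrBimon

/-- A structure of binomial graded bimonoid on the graded object `(A n)_{n ≥ 1}` of a symmetric
monoidal category enriched over commutative monoids. -/
structure BinGrBimonStruct {C : Type u} [Category.{v} C] [MonoidalCategory C]
    [SymmetricCategory C] [AdditiveMonoidalCategory C] (A : ℕ+ → C) where
  mul : ∀ n p : ℕ+, A n ⊗ A p ⟶ A (n + p)
  comul : ∀ n p : ℕ+, A (n + p) ⟶ A n ⊗ A p
  /-- `mul n p` followed by `comul q r`, for `n, p, q, r ≥ 1` with `n + p = m = q + r`. -/
  mul_comul : ∀ (n p q r m : ℕ), 1 ≤ n → 1 ≤ p → 1 ≤ q → 1 ≤ r →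
    ∀ (h : n + p = m) (h' : q + r = m),
      BinGrBimon.extMul A mul n p m h ≫ BinGrBimon.extComul A comul q r m h' =
        ∑ x : BinGrBimon.Splitting n p q r, BinGrBimon.crossTerm A mul comul x
  comul_mul : ∀ n p : ℕ+,
    comul n p ≫ mul n p = Nat.choose ((n : ℕ) + (p : ℕ)) (n : ℕ) • 𝟙 (A (n + p))

/-- A binomial graded bimonoid: a graded object with a structure of binomial graded bimonoid. -/
structure BinGrBimon (C : Type u) [Category.{v} C] [MonoidalCategory C]
    [SymmetricCategory C] [AdditiveMonoidalCategory C] where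
  obj : ℕ+ → C
  str : BinGrBimonStruct obj

namespace BinGrBimon

variable {C : Type u} [Category.{v} C] [MonoidalCategory C]
  [SymmetricCategory C] [AdditiveMonoidalCategory C]

/-- A morphism of binomial graded bimonoids: a graded morphism compatible with the
multiplications and with the comultiplications. -/
@[ext]
structure Hom (B B' : BinGrBimon C) where
  app : ∀ n : ℕ+, B.obj n ⟶ B'.obj n
  mul_app : ∀ n p : ℕ+, B.str.mul n p ≫ app (n + p) = (app n ⊗ₘ app p) ≫ B'.str.mul n p
  comul_app : ∀ n p : ℕ+, B.str.comul n p ≫ (app n ⊗ₘ app p) = app (n + p) ≫ B'.str.comul n p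

/-- The category of binomial graded bimonoids, with degreewise identities and composition. -/
instance category : Category (BinGrBimon C) where
  Hom := Hom
  id B :=
    { app := fun n => 𝟙 (B.obj n)
      mul_app := fun n p => by simp
      comul_app := fun n p => by simp }
  comp f g :=
    { app := fun n => f.app n ≫ g.app n
      mul_app := fun n p => by
        rw [← Category.assoc, f.mul_app, Category.assoc, g.mul_app, ← Category.assoc,
          MonoidalCategory.tensorHom_comp_tensorHom]
      comul_app := fun n p => by
        rw [Category.assoc, ← g.comul_app, ← Category.assoc, ← f.comul_app, Category.assoc,
          MonoidalCategory.tensorHom_comp_tensorHom] }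
  id_comp f := by apply Hom.ext; funext n; exact Category.id_comp _
  comp_id f := by apply Hom.ext; funext n; exact Category.comp_id _
  assoc f g h := by apply Hom.ext; funext n; exact Category.assoc _ _ _

end BinGrBimon

/-! A binomial graded bimonoid is determined by its degree `1` part. A graded map `F` with `F 0 = 𝟙`
and `F 1 = e` that respects `∇` must satisfy `(n + 2) F (n + 2) = Δ ≫ ∇ ≫ F (n + 2) = Δ ≫ (F (n + 1)
⊗ₘ e) ≫ ∇`, with indices `(n + 1, 1)`. Over `ℚ≥0` this can be solved for `F (n + 2)`, and `lift`
takes it as definition.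

The compatibility axiom rewrites `∇ ≫ Δ` through operations of other indices. If `F` commutes with
those, it commutes with `∇ ≫ Δ` (`mul_comul_naturality`). For `∇_{n+1,1} ≫ Δ_{n+1,1}` only unitors
and operations of index `(n, 1)` occur, so induction gives index `(n, 1)` for all `n`
(`lift_natural_one`). General indices follow by cancelling `Δ_{m+1,1}`, a split mono, or
`∇_{m+1,1}`, a split epi. If `e` is invertible, the lifts of `e` and of its inverse are mutually
inverse (`lift_comp_lift`). -/

namespace BinGrBimon

/-! ### Graded maps and operations extended to degree zero -/

section Ext

variable {C : Type u} [Category.{v} C] [MonoidalCategory C]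

/-- A graded map (on extended families) commutes with the multiplications of index `(a, b)`. -/
def MulNat (A B : ℕ+ → C) (mulA : ∀ n p : ℕ+, A n ⊗ A p ⟶ A (n + p))
    (mulB : ∀ n p : ℕ+, B n ⊗ B p ⟶ B (n + p)) (F : ∀ n, extObj A n ⟶ extObj B n)
    (a b : ℕ) : Prop :=
  ∀ (m : ℕ) (h : a + b = m),
    extMul A mulA a b m h ≫ F m = (F a ⊗ₘ F b) ≫ extMul B mulB a b m h

/-- A graded map (on extended families) commutes with the comultiplications of index `(a, b)`. -/
def ComulNat (A B : ℕ+ → C) (comulA : ∀ n p : ℕ+, A (n + p) ⟶ A n ⊗ A p)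
    (comulB : ∀ n p : ℕ+, B (n + p) ⟶ B n ⊗ B p) (F : ∀ n, extObj A n ⟶ extObj B n)
    (a b : ℕ) : Prop :=
  ∀ (m : ℕ) (h : a + b = m),
    extComul A comulA a b m h ≫ (F a ⊗ₘ F b) = F m ≫ extComul B comulB a b m h

variable {A B : ℕ+ → C} {mulA : ∀ n p : ℕ+, A n ⊗ A p ⟶ A (n + p)}
  {mulB : ∀ n p : ℕ+, B n ⊗ B p ⟶ B (n + p)} {comulA : ∀ n p : ℕ+, A (n + p) ⟶ A n ⊗ A p}
  {comulB : ∀ n p : ℕ+, B (n + p) ⟶ B n ⊗ B p} {F : ∀ n, extObj A n ⟶ extObj B n}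

lemma mulNat_zero_left (h0 : F 0 = 𝟙 (𝟙_ C)) (b : ℕ) : MulNat A B mulA mulB F 0 b := by
  intro m h
  obtain rfl : b = m := by omega
  rw [h0]
  -- The `eqToHom` in `extMul` is now definitionally an identity; what remains is naturality of the
  -- unitor.
  have key : ((λ_ (extObj A b)).hom ≫ 𝟙 _) ≫ F b =
      (𝟙 (𝟙_ C) ⊗ₘ F b) ≫ (λ_ (extObj B b)).hom ≫ 𝟙 _ := by
    simp
  exact key

lemma mulNat_zero_right (h0 : F 0 = 𝟙 (𝟙_ C)) (a : ℕ) : MulNat A B mulA mulB F a 0 := by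
  -- `extMul` uses the left unitor at `(0, 0)` and the right one only at `(a + 1, 0)`.
  cases a with
  | zero => exact mulNat_zero_left h0 0
  | succ a =>
    intro m h
    obtain rfl : a + 1 = m := by omega
    rw [h0]
    have key : ((ρ_ (extObj A (a + 1))).hom ≫ 𝟙 _) ≫ F (a + 1) =
        (F (a + 1) ⊗ₘ 𝟙 (𝟙_ C)) ≫ (ρ_ (extObj B (a + 1))).hom ≫ 𝟙 _ := by
      simp
    exact key

lemma comulNat_zero_left (h0 : F 0 = 𝟙 (𝟙_ C)) (b : ℕ) : ComulNat A B comulA comulB F 0 b := by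
  intro m h
  obtain rfl : b = m := by omega
  rw [h0]
  have key : (𝟙 _ ≫ (λ_ (extObj A b)).inv) ≫ (𝟙 (𝟙_ C) ⊗ₘ F b) =
      F b ≫ 𝟙 _ ≫ (λ_ (extObj B b)).inv := by
    simp
  exact key

lemma comulNat_zero_right (h0 : F 0 = 𝟙 (𝟙_ C)) (a : ℕ) : ComulNat A B comulA comulB F a 0 := by
  cases a with
  | zero => exact comulNat_zero_left h0 0
  | succ a =>
    intro m h
    obtain rfl : a + 1 = m := by omega
    rw [h0]
    have key : (𝟙 _ ≫ (ρ_ (extObj A (a + 1))).inv) ≫ (F (a + 1) ⊗ₘ 𝟙 (𝟙_ C)) =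
        F (a + 1) ≫ 𝟙 _ ≫ (ρ_ (extObj B (a + 1))).inv := by
      simp
    exact key

/-- The map slides through the two comultiplications, then `tensorμ` by naturality, then the two
multiplications; only these four indices matter. -/
lemma crossTerm_naturality [SymmetricCategory C] {n p q r : ℕ} (x : Splitting n p q r)
    (h₁ : ComulNat A B comulA comulB F x.1.1.1 x.1.1.2)
    (h₂ : ComulNat A B comulA comulB F x.1.2.1 x.1.2.2)
    (h₃ : MulNat A B mulA mulB F x.1.1.1 x.1.2.1)
    (h₄ : MulNat A B mulA mulB F x.1.1.2 x.1.2.2) :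
    crossTerm A mulA comulA x ≫ (F q ⊗ₘ F r) = (F n ⊗ₘ F p) ≫ crossTerm B mulB comulB x := by
  unfold crossTerm
  rw [tensorHom_comp_tensorHom_assoc, ← h₁, ← h₂, ← tensorHom_comp_tensorHom_assoc,
    tensorμ_natural_assoc, Category.assoc, Category.assoc, tensorHom_comp_tensorHom,
    tensorHom_comp_tensorHom, h₃, h₄]

/-- The identification of `A n` with the extended family in degree `n`. -/
lemma extObj_coe (A : ℕ+ → C) (n : ℕ+) : A n = extObj A n := by
  obtain ⟨n, rfl⟩ : ∃ k : ℕ, n = k.succPNat := ⟨n.natPred, n.succPNat_natPred.symm⟩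
  rfl

/-- The restriction to positive degrees of a graded map between extended families. -/
def restrict (F : ∀ n, extObj A n ⟶ extObj B n) (n : ℕ+) : A n ⟶ B n :=
  eqToHom (extObj_coe A n) ≫ F n ≫ eqToHom (extObj_coe B n).symm

lemma restrict_succPNat (F : ∀ n, extObj A n ⟶ extObj B n) (n : ℕ) :
    restrict F n.succPNat = F (n + 1) := by
  change 𝟙 _ ≫ F (n + 1) ≫ 𝟙 _ = _
  exact (Category.id_comp _).trans (Category.comp_id _)

lemma eqToHom_comp_restrict (F : ∀ n, extObj A n ⟶ extObj B n) {n m : ℕ+} (h : n = m) :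
    eqToHom (congrArg A h) ≫ restrict F m = restrict F n ≫ eqToHom (congrArg B h) := by
  subst h; simp

lemma restrict_comp_restrict {F : ∀ n, extObj A n ⟶ extObj B n}
    {G : ∀ n, extObj B n ⟶ extObj A n} (h : ∀ n, F n ≫ G n = 𝟙 _) (n : ℕ+) :
    restrict F n ≫ restrict G n = 𝟙 (A n) := by
  simp [restrict, reassoc_of% h]

end Ext

/-! ### Sums of morphisms and the bimonoid axioms in extended form -/

section Additive

variable {C : Type u} [Category.{v} C] [MonoidalCategory C] [AdditiveMonoidalCategory C]

lemma sum_comp {X Y Z : C} {ι : Type*} (s : Finset ι) (f : ι → (X ⟶ Y)) (g : Y ⟶ Z) :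
    (∑ i ∈ s, f i) ≫ g = ∑ i ∈ s, f i ≫ g :=
  map_sum (⟨⟨fun f => f ≫ g, AdditiveMonoidalCategory.zero_comp g⟩,
    fun f f' => AdditiveMonoidalCategory.add_comp f f' g⟩ : (X ⟶ Y) →+ (X ⟶ Z)) f s

lemma comp_sum {X Y Z : C} {ι : Type*} (s : Finset ι) (f : X ⟶ Y) (g : ι → (Y ⟶ Z)) :
    f ≫ (∑ i ∈ s, g i) = ∑ i ∈ s, f ≫ g i :=
  map_sum (⟨⟨fun g => f ≫ g, AdditiveMonoidalCategory.comp_zero f⟩,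
    fun g g' => AdditiveMonoidalCategory.comp_add f g g'⟩ : (Y ⟶ Z) →+ (X ⟶ Z)) g s

lemma extComul_comp_extMul [SymmetricCategory C] {A : ℕ+ → C} (S : BinGrBimonStruct A)
    (a b m : ℕ) (h : a + 1 + (b + 1) = m) :
    extComul A S.comul (a + 1) (b + 1) m h ≫ extMul A S.mul (a + 1) (b + 1) m h =
      Nat.choose m (a + 1) • 𝟙 (extObj A m) := by
  -- `extMul` and `extComul` reduce only when the total degree is visibly a successor.
  obtain ⟨m, rfl⟩ : ∃ k, m = k + 1 := ⟨m - 1, by omega⟩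
  have key : ∀ (k : ℕ+) (hk : k = a.succPNat + b.succPNat),
      eqToHom (congrArg A hk) ≫ (S.comul a.succPNat b.succPNat ≫ S.mul a.succPNat b.succPNat) ≫
        eqToHom (congrArg A hk.symm) = Nat.choose k (a + 1) • 𝟙 (A k) := by
    rintro _ rfl
    simp [S.comul_mul]
  have := key m.succPNat (PNat.eq h.symm)
  simp only [extComul, extMul]
  exact (Category.assoc _ _ _).trans ((congrArg _ (Category.assoc _ _ _)).symm.trans this)

/-- If a graded map commutes with all the (co)multiplications that occur in the compatibility
axiom at `(n, p, q, r)`, then it commutes with multiplication followed by comultiplication. -/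
lemma mul_comul_naturality [SymmetricCategory C] {A B : ℕ+ → C} (S : BinGrBimonStruct A)
    (T : BinGrBimonStruct B) {F : ∀ n, extObj A n ⟶ extObj B n} {n p q r m : ℕ}
    (hn : 1 ≤ n) (hp : 1 ≤ p) (hq : 1 ≤ q) (hr : 1 ≤ r) (h : n + p = m) (h' : q + r = m)
    (H : ∀ a b c d : ℕ, a + b = n → c + d = p → a + c = q → b + d = r →
      ComulNat A B S.comul T.comul F a b ∧ ComulNat A B S.comul T.comul F c d ∧
        MulNat A B S.mul T.mul F a c ∧ MulNat A B S.mul T.mul F b d) :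
    extMul A S.mul n p m h ≫ extComul A S.comul q r m h' ≫ (F q ⊗ₘ F r) =
      (F n ⊗ₘ F p) ≫ extMul B T.mul n p m h ≫ extComul B T.comul q r m h' := by
  rw [T.mul_comul n p q r m hn hp hq hr h h', ← Category.assoc,
    S.mul_comul n p q r m hn hp hq hr h h', sum_comp, comp_sum]
  refine Finset.sum_congr rfl fun x _ => ?_
  obtain ⟨h₁, h₂, h₃, h₄⟩ := H _ _ _ _ x.2.1 x.2.2.1 x.2.2.2.1 x.2.2.2.2
  exact crossTerm_naturality x h₁ h₂ h₃ h₄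

lemma restrict_mul [SymmetricCategory C] {A B : ℕ+ → C} (S : BinGrBimonStruct A)
    (T : BinGrBimonStruct B) {F : ∀ n, extObj A n ⟶ extObj B n}
    (hF : ∀ a b, MulNat A B S.mul T.mul F a b) (n p : ℕ+) :
    S.mul n p ≫ restrict F (n + p) = (restrict F n ⊗ₘ restrict F p) ≫ T.mul n p := by
  obtain ⟨n, rfl⟩ : ∃ k : ℕ, n = k.succPNat := ⟨n.natPred, n.succPNat_natPred.symm⟩
  obtain ⟨p, rfl⟩ : ∃ k : ℕ, p = k.succPNat := ⟨p.natPred, p.succPNat_natPred.symm⟩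
  have h : n + 1 + (p + 1) = n + p + 1 + 1 := by omega
  have key := hF (n + 1) (p + 1) (n + p + 1 + 1) h
  have e : n.succPNat + p.succPNat = (n + p + 1).succPNat := PNat.eq h
  rw [← restrict_succPNat F, ← restrict_succPNat F, ← restrict_succPNat F] at key
  simp only [extMul] at key
  rw [← cancel_mono (eqToHom (congrArg B e)), Category.assoc, Category.assoc,
    ← eqToHom_comp_restrict F e]
  exact (Category.assoc _ _ _).symm.trans key

lemma restrict_comul [SymmetricCategory C] {A B : ℕ+ → C} (S : BinGrBimonStruct A)
    (T : BinGrBimonStruct B) {F : ∀ n, extObj A n ⟶ extObj B n}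
    (hF : ∀ a b, ComulNat A B S.comul T.comul F a b) (n p : ℕ+) :
    S.comul n p ≫ (restrict F n ⊗ₘ restrict F p) = restrict F (n + p) ≫ T.comul n p := by
  obtain ⟨n, rfl⟩ : ∃ k : ℕ, n = k.succPNat := ⟨n.natPred, n.succPNat_natPred.symm⟩
  obtain ⟨p, rfl⟩ : ∃ k : ℕ, p = k.succPNat := ⟨p.natPred, p.succPNat_natPred.symm⟩
  have h : n + 1 + (p + 1) = n + p + 1 + 1 := by omega
  have key := hF (n + 1) (p + 1) (n + p + 1 + 1) h
  have e : (n + p + 1).succPNat = n.succPNat + p.succPNat := PNat.eq h.symm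
  rw [← restrict_succPNat F, ← restrict_succPNat F, ← restrict_succPNat F] at key
  simp only [extComul] at key
  rw [← cancel_epi (eqToHom (congrArg A e)), ← Category.assoc _ (restrict F _),
    eqToHom_comp_restrict F e, Category.assoc]
  exact (Category.assoc _ _ _).symm.trans key

end Additive

/-! ### Division by positive integers -/

section Linear

variable {C : Type u} [Category.{v} C] [MonoidalCategory C] [AdditiveMonoidalCategory C]
  [LinearMonoidalCategory ℚ≥0 C]

lemma inv_smul_nsmul {X Y : C} (n : ℕ) (f : X ⟶ Y) :
    ((n + 1 : ℕ) : ℚ≥0)⁻¹ • ((n + 1) • f) = f := by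
  rw [← Nat.cast_smul_eq_nsmul ℚ≥0, smul_smul, inv_mul_cancel₀ (by positivity), one_smul]

end Linear

/-! ### Extending a degree one map to all degrees -/

section Lift

variable {C : Type u} [Category.{v} C] [MonoidalCategory C] [SymmetricCategory C]
  [AdditiveMonoidalCategory C] [LinearMonoidalCategory ℚ≥0 C]

/-- The graded map between (extended) binomial graded bimonoids induced by a map in degree `1`. -/
def lift {A B : ℕ+ → C} (S : BinGrBimonStruct A) (T : BinGrBimonStruct B)
    (e : extObj A 1 ⟶ extObj B 1) : ∀ n, extObj A n ⟶ extObj B n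
  | 0 => 𝟙 (𝟙_ C)
  | 1 => e
  -- The scalar is the inverse of `Nat.choose (n + 2) (n + 1) = n + 2`.
  | n + 2 => ((n + 2 : ℕ) : ℚ≥0)⁻¹ • (extComul A S.comul (n + 1) 1 (n + 2) rfl ≫
      (lift S T e (n + 1) ⊗ₘ e) ≫ extMul B T.mul (n + 1) 1 (n + 2) rfl)

/-- Up to an invertible scalar, comultiplying and then multiplying is the identity. -/
lemma inv_smul_extComul_comp_extMul {A : ℕ+ → C} (S : BinGrBimonStruct A) (n : ℕ) :
    ((n + 2 : ℕ) : ℚ≥0)⁻¹ • (extComul A S.comul (n + 1) 1 (n + 2) rfl ≫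
      extMul A S.mul (n + 1) 1 (n + 2) rfl) = 𝟙 (extObj A (n + 2)) := by
  rw [extComul_comp_extMul S n 0 (n + 2) rfl, Nat.choose_succ_self_right]
  exact inv_smul_nsmul (n + 1) _

/-- `Δ_{n+1,1}` is a split mono, with retraction a rational multiple of `∇_{n+1,1}`. -/
lemma comp_extComul_cancel {A : ℕ+ → C} (S : BinGrBimonStruct A) (n : ℕ) {X : C}
    {f g : X ⟶ extObj A (n + 2)}
    (h : f ≫ extComul A S.comul (n + 1) 1 (n + 2) rfl =
      g ≫ extComul A S.comul (n + 1) 1 (n + 2) rfl) : f = g := by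
  rw [← Category.comp_id f, ← Category.comp_id g, ← inv_smul_extComul_comp_extMul S n,
    LinearMonoidalCategory.comp_smul, LinearMonoidalCategory.comp_smul, ← Category.assoc, h,
    Category.assoc]

lemma extMul_comp_cancel {A : ℕ+ → C} (S : BinGrBimonStruct A) (n : ℕ) {X : C}
    {f g : extObj A (n + 2) ⟶ X}
    (h : extMul A S.mul (n + 1) 1 (n + 2) rfl ≫ f = extMul A S.mul (n + 1) 1 (n + 2) rfl ≫ g) :
    f = g := by
  rw [← Category.id_comp f, ← Category.id_comp g, ← inv_smul_extComul_comp_extMul S n,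
    LinearMonoidalCategory.smul_comp, LinearMonoidalCategory.smul_comp, Category.assoc, h,
    Category.assoc]

variable {A B : ℕ+ → C} (S : BinGrBimonStruct A) (T : BinGrBimonStruct B)
  (e : extObj A 1 ⟶ extObj B 1)

lemma lift_natural_one (n : ℕ) :
    ComulNat A B S.comul T.comul (lift S T e) n 1 ∧ MulNat A B S.mul T.mul (lift S T e) n 1 := by
  induction n with
  | zero => exact ⟨comulNat_zero_left rfl 1, mulNat_zero_left rfl 1⟩
  | succ n ih =>
    have key := mul_comul_naturality S T (F := lift S T e) (n := n + 1) (p := 1) (q := n + 1)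
      (r := 1) (m := n + 2) (by omega) le_rfl (by omega) le_rfl rfl rfl (by
        intro a b c d h₁ h₂ h₃ h₄
        -- Since `c + d = 1` and `b + d = 1`, only two splittings exist: one involves unitors alone,
        -- the other the operations of index `(n, 1)`.
        obtain ⟨rfl, rfl, rfl, rfl⟩ | ⟨rfl, rfl, rfl, rfl⟩ :
            (a = n + 1 ∧ b = 0 ∧ c = 0 ∧ d = 1) ∨ (a = n ∧ b = 1 ∧ c = 1 ∧ d = 0) := by omega
        · exact ⟨comulNat_zero_right rfl _, comulNat_zero_left rfl _, mulNat_zero_right rfl _,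
            mulNat_zero_left rfl _⟩
        · exact ⟨ih.1, comulNat_zero_right rfl _, ih.2, mulNat_zero_right rfl _⟩)
    have hF : lift S T e (n + 2) = ((n + 2 : ℕ) : ℚ≥0)⁻¹ •
        (extComul A S.comul (n + 1) 1 (n + 2) rfl ≫ (lift S T e (n + 1) ⊗ₘ lift S T e 1) ≫
          extMul B T.mul (n + 1) 1 (n + 2) rfl) := rfl
    constructor
    · rintro _ rfl
      change _ = lift S T e (n + 2) ≫ _
      rw [hF, LinearMonoidalCategory.smul_comp]
      simp only [Category.assoc]
      -- `key` moves `F` past `∇ ≫ Δ`, so that the scaled `Δ ≫ ∇` of the source cancels.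
      rw [← key, ← Category.assoc, ← LinearMonoidalCategory.smul_comp,
        inv_smul_extComul_comp_extMul, Category.id_comp]
    · rintro _ rfl
      change _ ≫ lift S T e (n + 2) = _
      -- Dually, the scaled `Δ ≫ ∇` that cancels here is that of the target.
      rw [hF, LinearMonoidalCategory.comp_smul, ← Category.assoc, ← Category.assoc,
        Category.assoc (extMul A _ _ _ _ _), key, Category.assoc, Category.assoc,
        ← LinearMonoidalCategory.comp_smul, ← LinearMonoidalCategory.comp_smul,
        inv_smul_extComul_comp_extMul, Category.comp_id]

lemma lift_mulNat (m : ℕ) : ∀ a b : ℕ, a + b = m →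
    MulNat A B S.mul T.mul (lift S T e) a b := by
  induction m with
  | zero =>
    intro a b h
    obtain rfl : a = 0 := by omega
    exact mulNat_zero_left rfl b
  | succ m ih =>
    intro a b h
    rcases Nat.eq_zero_or_pos a with rfl | ha
    · exact mulNat_zero_left rfl b
    rcases Nat.eq_zero_or_pos b with rfl | hb
    · exact mulNat_zero_right rfl a
    obtain ⟨m, rfl⟩ : ∃ k, m = k + 1 := ⟨m - 1, by omega⟩
    intro k hm
    obtain rfl : k = m + 2 := by omega
    apply comp_extComul_cancel T m
    rw [Category.assoc, ← (lift_natural_one S T e (m + 1)).1 _ rfl, Category.assoc]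
    refine mul_comul_naturality S T ha hb (by omega) le_rfl hm rfl ?_
    intro a' b' c d h₁ h₂ h₃ h₄
    -- As `b' + d = 1`, the comultiplications have second index `0` or `1`, and `∇_{b',d}` is a
    -- unitor. Only `∇_{a',c}`, of total degree one less, needs the induction hypothesis.
    obtain ⟨rfl, rfl⟩ | ⟨rfl, rfl⟩ : (b' = 0 ∧ d = 1) ∨ (b' = 1 ∧ d = 0) := by omega
    · exact ⟨comulNat_zero_right rfl _, (lift_natural_one S T e c).1, ih _ _ h₃,
        mulNat_zero_left rfl _⟩
    · exact ⟨(lift_natural_one S T e a').1, comulNat_zero_right rfl _, ih _ _ h₃,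
        mulNat_zero_right rfl _⟩

lemma lift_comulNat (m : ℕ) : ∀ a b : ℕ, a + b = m →
    ComulNat A B S.comul T.comul (lift S T e) a b := by
  induction m with
  | zero =>
    intro a b h
    obtain rfl : a = 0 := by omega
    exact comulNat_zero_left rfl b
  | succ m ih =>
    intro a b h
    rcases Nat.eq_zero_or_pos a with rfl | ha
    · exact comulNat_zero_left rfl b
    rcases Nat.eq_zero_or_pos b with rfl | hb
    · exact comulNat_zero_right rfl a
    obtain ⟨m, rfl⟩ : ∃ k, m = k + 1 := ⟨m - 1, by omega⟩
    intro k hm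
    obtain rfl : k = m + 2 := by omega
    apply extMul_comp_cancel S m
    rw [← Category.assoc _ (lift S T e (m + 2)), (lift_natural_one S T e (m + 1)).2 _ rfl,
      Category.assoc]
    refine mul_comul_naturality S T (by omega) le_rfl ha hb rfl hm ?_
    intro a' b' c d h₁ h₂ h₃ h₄
    -- Dual situation: `c + d = 1`, and only `Δ_{a',b'}` needs the induction hypothesis.
    obtain ⟨rfl, rfl⟩ | ⟨rfl, rfl⟩ : (c = 0 ∧ d = 1) ∨ (c = 1 ∧ d = 0) := by omega
    · exact ⟨ih _ _ h₁, comulNat_zero_left rfl _, mulNat_zero_right rfl _,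
        (lift_natural_one S T e b').2⟩
    · exact ⟨ih _ _ h₁, comulNat_zero_right rfl _, (lift_natural_one S T e a').2,
        mulNat_zero_right rfl _⟩

/-- Moving the second lift past `∇_{n+1,1}` puts the composites in degrees `n + 1` and `1` side by
side; both are identities, leaving the scaled `Δ ≫ ∇`. -/
lemma lift_comp_lift (e' : extObj B 1 ⟶ extObj A 1) (h : e ≫ e' = 𝟙 _) (n : ℕ) :
    lift S T e n ≫ lift T S e' n = 𝟙 _ := by
  induction n with
  | zero => exact Category.id_comp _
  | succ n ih =>
    cases n with
    | zero => exact h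
    | succ n =>
      have hF : lift S T e (n + 2) = ((n + 2 : ℕ) : ℚ≥0)⁻¹ •
        (extComul A S.comul (n + 1) 1 (n + 2) rfl ≫ (lift S T e (n + 1) ⊗ₘ e) ≫
          extMul B T.mul (n + 1) 1 (n + 2) rfl) := rfl
      change lift S T e (n + 2) ≫ lift T S e' (n + 2) = 𝟙 _
      rw [hF, LinearMonoidalCategory.smul_comp, Category.assoc, Category.assoc,
        (lift_natural_one T S e' (n + 1)).2 _ rfl, tensorHom_comp_tensorHom_assoc, ih]
      change _ • (_ ≫ (_ ⊗ₘ (e ≫ e')) ≫ _) = _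
      rw [h, id_tensorHom_id, Category.id_comp, inv_smul_extComul_comp_extMul]

/-- The morphism of binomial graded bimonoids induced by a map in degree `1`. -/
def liftHom (B B' : BinGrBimon C) (e : extObj B.obj 1 ⟶ extObj B'.obj 1) : B ⟶ B' :=
  Hom.mk (restrict (lift B.str B'.str e))
    (restrict_mul _ _ fun a b => lift_mulNat _ _ e _ a b rfl)
    (restrict_comul _ _ fun a b => lift_comulNat _ _ e _ a b rfl)

/-- Binomial graded bimonoids isomorphic in degree `1` are isomorphic. -/
def liftIso (B B' : BinGrBimon C) (e : extObj B.obj 1 ≅ extObj B'.obj 1) : B ≅ B' where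
  hom := liftHom B B' e.hom
  inv := liftHom B' B e.inv
  hom_inv_id := Hom.ext (funext (restrict_comp_restrict
    (lift_comp_lift _ _ e.hom e.inv e.hom_inv_id)))
  inv_hom_id := Hom.ext (funext (restrict_comp_restrict
    (lift_comp_lift _ _ e.inv e.hom e.inv_hom_id)))

end Lift

end BinGrBimon

theorem mainTheorem12 {C : Type u} [Category.{v} C] [MonoidalCategory C] [SymmetricCategory C]
    [AdditiveMonoidalCategory C] [LinearMonoidalCategory ℚ≥0 C] :
    (∀ (A : ℕ+ → C) (S₁ S₂ : BinGrBimonStruct A),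
      Nonempty ((BinGrBimon.mk A S₁ : BinGrBimon C) ≅ BinGrBimon.mk A S₂)) ∧
    (∀ B B' : BinGrBimon C, Nonempty (B.obj 1 ≅ B'.obj 1) → Nonempty (B ≅ B')) := by
  have main : ∀ B B' : BinGrBimon C, Nonempty (B.obj 1 ≅ B'.obj 1) → Nonempty (B ≅ B') := by
    rintro B B' ⟨e⟩
    -- `extObj B.obj 1` is `B.obj 1` by definition.
    exact ⟨BinGrBimon.liftIso B B' e⟩
  exact ⟨fun A S₁ S₂ => main _ _ ⟨Iso.refl _⟩, main⟩
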